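/- Let $\mathbb F_q$ be a finite field, $l,n\ge 1$, and $\mathcal R=\mathbb F_q^l$ (product ring), with standard basis $\mathbf e_1,\dots,\mathbf e_l$. Let $\Theta=\theta_1\times\cdots\times\theta_l$ with $\theta_i\in\mathrm{Aut}(\mathbb F_q)$ and let $\mathbf a=(a_1,\dots,a_l)\in\mathcal R^\times$. Let $\mathcal C\subseteq\mathcal R^n$ be a $(\Theta,0,\mathbf a)$-cyclic code, i.e. an $\mathcal R$-submodule such that $(\mathbf c_0,\dots,\mathbf c_{n-1})\in\mathcal C$ implies $(\mathbf a\,\Theta(\mathbf c_{n-1}),\Theta(\mathbf c_0),\dots,\Theta(\mathbf c_{n-2}))\in\mathcal C$. Write $\mathcal C=\bigoplus_{i=1}^l \mathbf e_i\mathcal C_i$, where $\mathcal C_i\subseteq\mathbb F_q^n$ is the image of $\mathcal C$ under the $i$-th projection applied to every coordinate. Let $\mathbb F_q[x;\theta_i]$ be the skew polynomial ring with $xr=\theta_i(r)x$, and identify a word $(c_0,\dots,c_{n-1})\in\mathbb F_q^n$ with the class of $c_0+c_1x+\cdots+c_{n-1}x^{n-1}$ in the left module $\mathbb F_q[x;\theta_i]/\langle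 x^n-a_i\rangle$, where $\langle f\rangle$ denotes the left ideal generated by $f$. Suppose that for each $i$ there are $g_i,h_i\in\mathbb F_q[x;\theta_i]$ such that $\mathcal C_i=\langle g_i\rangle$ (the left submodule generated by the class of $g_i$) and $x^n-a_i=h_ig_i=g_ih_i$. For $h=\sum_{j=0}^{k}h_jx^j$ of degree $k$ in $\mathbb F_q[x;\theta]$ put $h^\dagger=\sum_{j=0}^{k}\theta^j(h_{k-j})x^j$. Suppose that $g_i$ is a right divisor of $h_i^\dagger$ in $\mathbb F_q[x;\theta_i]$ for each $i$. Let $M_0,\dots,M_{n-1}\in\mathrm{GL}(l,\mathbb F_q)$ satisfy $M_jM_j^T=\lambda I_l$ for all $j$, with one $\lambda\in\mathbb F_q^\times$, and let $\Phi:\mathcal R^n\to\mathbb F_q^{nl}$, $\Phi(\mathbf c_0,\dots,\mathbf c_{n-1})=(\mathbf c_0M_0,\dots,\mathbf c_{n-1}M_{n-1})$, be the corresponding Gray map. Then, with $k_i=n-\deg g_i$, there exists a $q$-ary quantum code with parameters $$\Bigl[\Bigl[\,nl,\;2\sum_{i=1}^l k_i-nl,\;\ge d_H\Bigr]\Bigr]_q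 ,$$ where $d_H$ is the minimum Hamming distance of $\Phi(\mathcal C)$. That is, there is a subspace $Q$ of $(\mathbb C^q)^{\otimes nl}$ of dimension $q^{\,2\sum_i k_i-nl}$ (in particular $2\sum_i k_i\ge nl$) whose minimum distance is at least $d_H$. Here the minimum distance of $Q$ is the largest $\delta$ such that for every error operator $E$ acting on fewer than $\delta$ qudits there is a scalar $c_E$ with $PEP=c_EP$, $P$ being the orthogonal projection onto $Q$; if $\dim Q=1$ it is moreover required, as usual, that $c_E=\operatorname{tr}(E)/q^{nl}$ ($Q$ is pure). -/

import Mathlib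

open scoped Matrix

noncomputable section

/-! ### Skew polynomial rings `F[x; θ]` with `x r = θ(r) x` -/

/-- A copy of `F` on which the monoid `ℕ` acts through the powers of `θ`, so that
`SkewPolynomial (Twist θ)` is the skew polynomial ring `F[x; θ, 0]`. -/
def Twist {F : Type*} [Field F] (_θ : F ≃+* F) : Type _ := F

instance Twist.instField {F : Type*} [Field F] (θ : F ≃+* F) : Field (Twist θ) :=
  inferInstanceAs (Field F)

instance Twist.instAction {F : Type*} [Field F] (θ : F ≃+* F) :
    MulSemiringAction (Multiplicative ℕ) (Twist θ) where
  smul k r := (θ : F → F)^[k.toAdd] r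
  one_smul _ := rfl
  mul_smul k m r := Function.iterate_add_apply (θ : F → F) k.toAdd m.toAdd r
  smul_zero k := Function.iterate_fixed (map_zero θ) k.toAdd
  smul_one k := Function.iterate_fixed (map_one θ) k.toAdd
  smul_add k r s := by
    change (θ : F → F)^[k.toAdd] (r + s : F) = ((θ : F → F)^[k.toAdd] r + (θ : F → F)^[k.toAdd] s : F)
    exact iterate_map_add θ k.toAdd r s
  smul_mul k r s := by
    change (θ : F → F)^[k.toAdd] (r * s : F) = ((θ : F → F)^[k.toAdd] r * (θ : F → F)^[k.toAdd] s : F)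
    exact iterate_map_mul θ k.toAdd r s

/-- The skew polynomial ring `F[x; θ, 0]`. -/
abbrev SkewPoly {F : Type*} [Field F] (θ : F ≃+* F) : Type _ := SkewPolynomial (Twist θ)

/-- The monomial `r x ^ k`. -/
def skewMonomial {F : Type*} [Field F] (θ : F ≃+* F) (k : ℕ) (r : F) : SkewPoly θ :=
  SkewPolynomial.monomial k (show Twist θ from r)

/-- The coefficient of `x ^ k`. -/
def skewCoeff {F : Type*} [Field F] {θ : F ≃+* F} (f : SkewPoly θ) (k : ℕ) : F :=
  SkewPolynomial.coeff f k

/-- The defining relation of the multiplication: `r x ^ k * s x ^ m = r θ ^ k (s) x ^ (k + m)`. -/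
theorem skewMonomial_mul {F : Type*} [Field F] (θ : F ≃+* F) (k m : ℕ) (r s : F) :
    skewMonomial θ k r * skewMonomial θ m s
      = skewMonomial θ (k + m) (r * (θ : F → F)^[k] s) := by
  unfold skewMonomial
  rw [SkewPolynomial.monomial_mul_monomial, SkewPolynomial.φ_iterate_apply]
  rfl

/-- The degree of a skew polynomial (`0` for the zero polynomial). -/
def skewDegree {F : Type*} [Field F] {θ : F ≃+* F} (f : SkewPoly θ) : ℕ :=
  (SkewPolynomial.support f).sup id

/-- The polynomial `x ^ n - α`. -/
def xPowSub {F : Type*} [Field F] (θ : F ≃+* F) (n : ℕ) (α : F) : SkewPoly θ :=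
  skewMonomial θ n 1 - skewMonomial θ 0 α

/-- `g` is a right divisor of `f`: `f = m g` for some `m`. -/
def RightDivides {F : Type*} [Field F] {θ : F ≃+* F} (g f : SkewPoly θ) : Prop :=
  ∃ m : SkewPoly θ, f = m * g

/-- `h† = h_k + θ(h_{k-1}) x + ⋯ + θ^k(h_0) x^k`, where `k = deg h`. -/
def skewDagger {F : Type*} [Field F] {θ : F ≃+* F} (h : SkewPoly θ) : SkewPoly θ :=
  ∑ i ∈ Finset.range (skewDegree h + 1),
    skewMonomial θ i ((θ : F → F)^[i] (skewCoeff h (skewDegree h - i)))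

/-- The polynomial `c_0 + c_1 x + ⋯ + c_{n-1} x^{n-1}` of a word `c`. -/
def wordPoly {F : Type*} [Field F] (θ : F ≃+* F) {n : ℕ} (c : Fin n → F) : SkewPoly θ :=
  ∑ j : Fin n, skewMonomial θ (j : ℕ) (c j)

/-- The left ideal `⟨x ^ n - α⟩` of `F[x; θ, 0]`. -/
def modIdeal {F : Type*} [Field F] (θ : F ≃+* F) (n : ℕ) (α : F) :
    Submodule (SkewPoly θ) (SkewPoly θ) :=
  Submodule.span (SkewPoly θ) {xPowSub θ n α}

/-- `C = ⟨g⟩`: words being identified with their classes in the left module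
`F[x; θ, 0] / ⟨x ^ n - α⟩`, the code `C` is the left submodule generated by the class of `g`. -/
def IsGeneratedBy {F : Type*} [Field F] (θ : F ≃+* F) {n : ℕ} (α : F)
    (C : Submodule F (Fin n → F)) (g : SkewPoly θ) : Prop :=
  ∀ c : Fin n → F, c ∈ C ↔
    (modIdeal θ n α).mkQ (wordPoly θ c) ∈
      Submodule.span (SkewPoly θ) {(modIdeal θ n α).mkQ g}

/-! ### Cyclic codes -/

/-- The matrix with ones above the diagonal, `α` in the lower left corner, and zeros elsewhere. -/
def shiftMatrix {A : Type*} [CommRing A] (n : ℕ) (α : A) : Matrix (Fin n) (Fin n) A :=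
  Matrix.of fun i j =>
    if (i : ℕ) + 1 = j then 1 else if (i : ℕ) + 1 = n ∧ (j : ℕ) = 0 then α else 0

/-- The pseudo-linear transformation `r ↦ θ(r) M + δ(r)` of `A ^ n`. -/
def pseudoLinear {A : Type*} [CommRing A] {n : ℕ} (θ : A ≃+* A) (δ : A →+ A)
    (M : Matrix (Fin n) (Fin n) A) (r : Fin n → A) : Fin n → A :=
  (fun j => θ (r j)) ᵥ* M + fun j => δ (r j)

/-- An `A`-linear code `C` of length `n` is `(θ, δ, α)`-cyclic. -/
def IsCyclicCode {A : Type*} [CommRing A] {n : ℕ} (θ : A ≃+* A) (δ : A →+ A) (α : A)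
    (C : Submodule A (Fin n → A)) : Prop :=
  ∀ c ∈ C, pseudoLinear θ δ (shiftMatrix n α) c ∈ C

/-- The component `C_i`, the image of the code `C` over `F ^ l` under the `i`-th projection
applied to every coordinate. -/
def component {F : Type*} [Field F] {l n : ℕ}
    (C : Submodule (Fin l → F) (Fin n → (Fin l → F))) (i : Fin l) :
    Submodule F (Fin n → F) :=
  (C.restrictScalars F).map
    ((LinearMap.proj i : (Fin l → F) →ₗ[F] F).compLeft (Fin n))

/-- The decomposition `C = e_1 C_1 ⊕ ⋯ ⊕ e_l C_l`. -/
theorem mem_iff_component {F : Type*} [Field F] {l n : ℕ}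
    (C : Submodule (Fin l → F) (Fin n → (Fin l → F))) (c : Fin n → (Fin l → F)) :
    c ∈ C ↔ ∀ i : Fin l, (fun j => c j i) ∈ component C i := by
  constructor
  · intro hc i
    exact ⟨c, hc, rfl⟩
  · intro h
    choose d hd hdc using h
    have hsum : c = ∑ i : Fin l, (Pi.single i (1 : F) : Fin l → F) • d i := by
      funext j k
      simp only [Finset.sum_apply, Pi.smul_apply, smul_eq_mul, Pi.mul_apply, Pi.single_apply,
        ite_mul, one_mul, zero_mul, Finset.sum_ite_eq, Finset.mem_univ, if_true]
      exact (congrFun (hdc k) j).symm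
    rw [hsum]
    exact C.sum_mem fun i _ => C.smul_mem _ (hd i)

/-! ### Gray maps and Hamming distance -/

/-- The Gray map `(a_0, …, a_{n-1}) ↦ (a_0 M_0, …, a_{n-1} M_{n-1})` from `(F ^ l) ^ n` to
`F ^ (n l)`, the blocks being written one after the other. -/
def grayMap {F : Type*} [Field F] {l n : ℕ} (M : Fin n → GL (Fin l) F)
    (c : Fin n → (Fin l → F)) : Fin (n * l) → F :=
  fun t => (c (finProdFinEquiv.symm t).1 ᵥ* (M (finProdFinEquiv.symm t).1 : Matrix (Fin l) (Fin l) F))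
    (finProdFinEquiv.symm t).2

/-- The Hamming distance of a code (a minimum, as soon as the code has two words). -/
def codeDist {F : Type*} [DecidableEq F] {N : ℕ} (C : Set (Fin N → F)) : ℕ :=
  sInf {d | ∃ u ∈ C, ∃ v ∈ C, u ≠ v ∧ hammingDist u v = d}

/-! ### Quantum codes -/

/-- The Hilbert space `(ℂ ^ q) ^ ⊗ N` of `N` qudits, where `q` is the size of the alphabet `A`, in
the orthonormal product basis indexed by the words of length `N` over `A`. -/
abbrev QuditSpace (A : Type*) (N : ℕ) : Type _ := EuclideanSpace ℂ (Fin N → A)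

/-- The matrix of the operator `E_1 ⊗ ⋯ ⊗ E_N` in the product basis. -/
def errorOperator {A : Type*} {N : ℕ} (E : Fin N → Matrix A A ℂ) :
    Matrix (Fin N → A) (Fin N → A) ℂ :=
  Matrix.of fun x y => ∏ t, E t (x t) (y t)

open Classical in
/-- The number of qudits on which `E_1 ⊗ ⋯ ⊗ E_N` acts. -/
def errorWeight {A : Type*} [DecidableEq A] {N : ℕ} (E : Fin N → Matrix A A ℂ) : ℕ :=
  (Finset.univ.filter fun t => E t ≠ 1).card

/-- `Q` detects all errors on fewer than `δ` qudits: `P E P = c_E P` for each of them, where `P` is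
the orthogonal projection onto `Q`. For a one-dimensional `Q` this condition is empty, and as usual
`Q` is then required to be pure: `c_E` is the normalized trace of `E`. -/
def DetectsBelow {A : Type*} [Fintype A] [DecidableEq A] {N : ℕ}
    (Q : Submodule ℂ (QuditSpace A N)) (δ : ℕ) : Prop :=
  ∀ E : Fin N → Matrix A A ℂ, errorWeight E < δ →
    ∃ c : ℂ,
      (∀ u ∈ Q, ∀ v ∈ Q,
        inner ℂ u (Matrix.toEuclideanLin (errorOperator E) v) = c * inner ℂ u v) ∧
      (Module.finrank ℂ Q = 1 →
        c = (errorOperator E).trace / (Fintype.card A : ℂ) ^ N)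

/-- `Q` is an `[[N, k, d]]_q` quantum code, `q` being the size of the alphabet `A`: its dimension is
`q ^ k` and its minimum distance is (exactly) `d`. -/
structure IsQuantumCode {A : Type*} [Fintype A] [DecidableEq A] {N : ℕ}
    (Q : Submodule ℂ (QuditSpace A N)) (k d : ℕ) : Prop where
  finrank_eq : Module.finrank ℂ Q = Fintype.card A ^ k
  minDist : IsGreatest {δ | DetectsBelow Q δ} d

end

/-! Write `D` for the Gray image of the code and `N = nl`. The classical half shows that `D`
contains its dual. For a component, the pairing of a word `c` with a shift of `h†` is a coefficient
of `c h`. If `c = p g`, then `c h = p (x^n - a)` with `deg p < deg h`, which has no terms in degrees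
from `deg h` to `n - 1`. So the shifts of `h†` lie in the dual; by dimension they fill it, and `g ∣
h†` puts them in the code (`dual_le_and_finrank_of_isGeneratedBy`). The Gray map multiplies scalar
products by `lam`, so the inclusion passes to `D` (`dualCode_map_grayMap_le`).

The quantum half is a CSS construction: `cssCode D` consists of the functions on `D` constant on
cosets of the dual. An error on a set `S` smaller than the distance cannot link two distinct words
of `D`, so only its diagonal matters. The dual restricts onto all words on `S`, so averaging the
diagonal over it gives the normalized trace (`detectsBelow_cssCode`). Purity is therefore automatic,
in every dimension. -/

/-! ### Duality for the standard scalar product. -/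

section DualCode

variable {F ι : Type*} [Field F] [Fintype ι]

/-- The dual code for the standard scalar product. -/
def dualCode (C : Submodule F (ι → F)) : Submodule F (ι → F) :=
  LinearMap.BilinForm.orthogonal (dotProductBilin F F) C

theorem mem_dualCode {C : Submodule F (ι → F)} {v : ι → F} :
    v ∈ dualCode C ↔ ∀ c ∈ C, c ⬝ᵥ v = 0 := Iff.rfl

theorem dotProductBilin_isRefl :
    LinearMap.BilinForm.IsRefl (dotProductBilin F F : LinearMap.BilinForm F (ι → F)) := fun v w h =>
  (dotProduct_comm w v).trans h

theorem dotProductBilin_nondegenerate :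
    LinearMap.BilinForm.Nondegenerate
      (dotProductBilin F F : (ι → F) →ₗ[F] (ι → F) →ₗ[F] F) :=
  ⟨fun v h => dotProduct_eq_zero v h,
    fun v h => dotProduct_eq_zero v fun w => (dotProduct_comm v w).trans (h w)⟩

theorem finrank_add_finrank_dualCode (C : Submodule F (ι → F)) :
    Module.finrank F C + Module.finrank F (dualCode C) = Fintype.card ι := by
  have h := LinearMap.BilinForm.finrank_orthogonal
    (dotProductBilin_nondegenerate (F := F) (ι := ι)) C
  have hle := Submodule.finrank_le C
  rw [Module.finrank_fintype_fun_eq_card] at h hle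
  change Module.finrank F (dualCode C) = _ at h
  omega

theorem dualCode_dualCode (C : Submodule F (ι → F)) : dualCode (dualCode C) = C :=
  LinearMap.BilinForm.orthogonal_orthogonal dotProductBilin_nondegenerate dotProductBilin_isRefl C

end DualCode

/-! ### Skew polynomials and dual containment of one component. -/

section SkewPolynomials

variable {F : Type*} [Field F] {θ : F ≃+* F}

theorem skewPoly_ext {f g : SkewPoly θ} (h : ∀ k, skewCoeff f k = skewCoeff g k) : f = g :=
  SkewPolynomial.ext h

theorem skewCoeff_add (f g : SkewPoly θ) (k : ℕ) :
    skewCoeff (f + g) k = skewCoeff f k + skewCoeff g k :=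
  SkewPolynomial.coeff_add f g k

theorem skewCoeff_sub (f g : SkewPoly θ) (k : ℕ) :
    skewCoeff (f - g) k = skewCoeff f k - skewCoeff g k :=
  SkewPolynomial.coeff_sub f g k

theorem skewCoeff_zero (k : ℕ) : skewCoeff (0 : SkewPoly θ) k = 0 := rfl

theorem skewCoeff_monomial (k m : ℕ) (r : F) :
    skewCoeff (skewMonomial θ k r) m = if k = m then r else 0 :=
  SkewPolynomial.coeff_monomial

theorem skewCoeff_sum {ι : Type*} (s : Finset ι) (f : ι → SkewPoly θ) (k : ℕ) :
    skewCoeff (∑ i ∈ s, f i) k = ∑ i ∈ s, skewCoeff (f i) k := by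
  induction s using Finset.cons_induction with
  | empty => simp [skewCoeff_zero]
  | cons a s ha ih => rw [Finset.sum_cons, Finset.sum_cons, skewCoeff_add, ih]

theorem skewCoeff_mul (f g : SkewPoly θ) (N : ℕ) :
    skewCoeff (f * g) N
      = ∑ i ∈ Finset.range (N + 1), skewCoeff f i * (θ : F → F)^[i] (skewCoeff g (N - i)) := by
  have key := SkewMonoidAlgebra.coeff_mul_antidiagonal_of_finset f g (Multiplicative.ofAdd N)
    ((Finset.HasAntidiagonal.antidiagonal N).map
      ⟨fun p => (Multiplicative.ofAdd p.1, Multiplicative.ofAdd p.2), fun p q h => by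
        rw [Prod.mk.injEq] at h
        exact Prod.ext h.1 h.2⟩) (by
      rintro ⟨x, y⟩
      rw [Finset.mem_map]
      constructor
      · rintro ⟨⟨a, b⟩, h, hab⟩
        obtain ⟨rfl, rfl⟩ := Prod.mk.inj hab
        exact congrArg Multiplicative.ofAdd (Finset.HasAntidiagonal.mem_antidiagonal.1 h)
      · intro h
        exact ⟨(x.toAdd, y.toAdd), Finset.HasAntidiagonal.mem_antidiagonal.2
          (congrArg Multiplicative.toAdd h), rfl⟩)
  rw [Finset.sum_map] at key
  refine Eq.trans key ?_
  exact Finset.Nat.sum_antidiagonal_eq_sum_range_succ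
    (fun i j => skewCoeff f i * (θ : F → F)^[i] (skewCoeff g j)) N

theorem iterate_eq_zero_iff (i : ℕ) {r : F} : (θ : F → F)^[i] r = 0 ↔ r = 0 := by
  constructor
  · intro h
    exact θ.injective.iterate i (h.trans (Function.iterate_fixed (map_zero θ) i).symm)
  · rintro rfl
    exact Function.iterate_fixed (map_zero θ) i

theorem skewCoeff_eq_zero_of_degree_lt {f : SkewPoly θ} {k : ℕ} (h : skewDegree f < k) :
    skewCoeff f k = 0 := by
  by_contra hne
  have : k ∈ SkewPolynomial.support f := SkewPolynomial.mem_support_iff.2 hne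
  exact absurd (Finset.le_sup (f := id) this) (not_le.2 h)

theorem skewCoeff_degree_ne_zero {f : SkewPoly θ} (hf : f ≠ 0) :
    skewCoeff f (skewDegree f) ≠ 0 := by
  have hne : (SkewPolynomial.support f).Nonempty :=
    Finset.nonempty_iff_ne_empty.2 fun h => hf (SkewPolynomial.support_eq_empty.1 h)
  obtain ⟨k, hk, hkf⟩ := Finset.exists_mem_eq_sup _ hne (id : ℕ → ℕ)
  have : skewDegree f = k := hkf
  rw [this]
  exact SkewPolynomial.mem_support_iff.1 hk

theorem skewDegree_le {f : SkewPoly θ} {d : ℕ} (h : ∀ k, d < k → skewCoeff f k = 0) :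
    skewDegree f ≤ d :=
  Finset.sup_le fun k hk => by
    by_contra hlt
    exact SkewPolynomial.mem_support_iff.1 hk (h k (not_le.1 hlt))

theorem le_skewDegree {f : SkewPoly θ} {d : ℕ} (h : skewCoeff f d ≠ 0) : d ≤ skewDegree f := by
  by_contra hlt
  exact h (skewCoeff_eq_zero_of_degree_lt (not_le.1 hlt))

theorem skewCoeff_mul_of_lt {f g : SkewPoly θ} {A B N : ℕ} (hf : ∀ k, A < k → skewCoeff f k = 0)
    (hg : ∀ k, B < k → skewCoeff g k = 0) (hN : A + B < N) : skewCoeff (f * g) N = 0 := by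
  rw [skewCoeff_mul]
  refine Finset.sum_eq_zero fun i _ => ?_
  rcases lt_or_ge A i with h | h
  · rw [hf i h, zero_mul]
  · rw [hg (N - i) (by omega), (iterate_eq_zero_iff i).2 rfl, mul_zero]

theorem skewCoeff_mul_add {f g : SkewPoly θ} {A B : ℕ} (hf : ∀ k, A < k → skewCoeff f k = 0)
    (hg : ∀ k, B < k → skewCoeff g k = 0) :
    skewCoeff (f * g) (A + B) = skewCoeff f A * (θ : F → F)^[A] (skewCoeff g B) := by
  rw [skewCoeff_mul, Finset.sum_eq_single A]
  · rw [Nat.add_sub_cancel_left]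
  · intro i _ hi
    rcases lt_or_gt_of_ne hi with h | h
    · rw [hg _ (by omega), (iterate_eq_zero_iff i).2 rfl, mul_zero]
    · rw [hf i h, zero_mul]
  · intro h
    exact absurd (Finset.mem_range.2 (by omega)) h

theorem skewDegree_mul {f g : SkewPoly θ} (hf : f ≠ 0) (hg : g ≠ 0) :
    skewDegree (f * g) = skewDegree f + skewDegree g := by
  refine le_antisymm (skewDegree_le fun k hk => ?_) (le_skewDegree ?_)
  · exact skewCoeff_mul_of_lt (fun _ => skewCoeff_eq_zero_of_degree_lt)
      (fun _ => skewCoeff_eq_zero_of_degree_lt) hk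
  · rw [skewCoeff_mul_add (fun _ => skewCoeff_eq_zero_of_degree_lt)
      (fun _ => skewCoeff_eq_zero_of_degree_lt)]
    exact mul_ne_zero (skewCoeff_degree_ne_zero hf)
      (mt (iterate_eq_zero_iff _).1 (skewCoeff_degree_ne_zero hg))

theorem skewCoeff_xPowSub (n : ℕ) (α : F) (k : ℕ) :
    skewCoeff (xPowSub θ n α) k = (if n = k then 1 else 0) - if 0 = k then α else 0 := by
  rw [xPowSub, skewCoeff_sub, skewCoeff_monomial, skewCoeff_monomial]

theorem skewDegree_xPowSub {n : ℕ} (hn : 0 < n) (α : F) : skewDegree (xPowSub θ n α) = n := by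
  refine le_antisymm (skewDegree_le fun k hk => ?_) (le_skewDegree ?_)
  · rw [skewCoeff_xPowSub, if_neg (by omega), if_neg (by omega), sub_zero]
  · rw [skewCoeff_xPowSub, if_pos rfl, if_neg (by omega), sub_zero]
    exact one_ne_zero

theorem xPowSub_ne_zero {n : ℕ} (hn : 0 < n) (α : F) : xPowSub θ n α ≠ 0 := fun h => by
  have := skewCoeff_xPowSub (θ := θ) n α n
  rw [h, skewCoeff_zero, if_pos rfl, if_neg (by omega), sub_zero] at this
  exact zero_ne_one this

theorem skewCoeff_wordPoly {n : ℕ} (c : Fin n → F) (k : ℕ) :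
    skewCoeff (wordPoly θ c) k = if h : k < n then c ⟨k, h⟩ else 0 := by
  rw [wordPoly, skewCoeff_sum]
  simp only [skewCoeff_monomial]
  split_ifs with h
  · rw [Finset.sum_eq_single ⟨k, h⟩]
    · exact if_pos rfl
    · intro j _ hj
      exact if_neg fun e => hj (Fin.ext e)
    · simp
  · exact Finset.sum_eq_zero fun j _ => if_neg (by omega)

theorem skewCoeff_wordPoly_fin {n : ℕ} (c : Fin n → F) (j : Fin n) :
    skewCoeff (wordPoly θ c) j = c j := by
  rw [skewCoeff_wordPoly, dif_pos j.2]

theorem skewDegree_wordPoly_lt {n : ℕ} (hn : 0 < n) (c : Fin n → F) :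
    skewDegree (wordPoly θ c) < n :=
  lt_of_le_of_lt (skewDegree_le (d := n - 1) fun k hk => by
    rw [skewCoeff_wordPoly, dif_neg (by omega)]) (by omega)

theorem wordPoly_injective (θ : F ≃+* F) (n : ℕ) :
    Function.Injective (wordPoly θ : (Fin n → F) → SkewPoly θ) := fun c d h => by
  funext j
  rw [← skewCoeff_wordPoly_fin (θ := θ) c j, h, skewCoeff_wordPoly_fin]

/-- The words of length `n` of the products `m f`, for the words `m` of length `m₀`. -/
noncomputable def mulRightWord (f : SkewPoly θ) (m₀ n : ℕ) : (Fin m₀ → F) →ₗ[F] (Fin n → F) where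
  toFun m j := ∑ i ∈ Finset.range ((j : ℕ) + 1),
    skewCoeff (wordPoly θ m) i * (θ : F → F)^[i] (skewCoeff f (j - i))
  map_add' a b := by
    funext j
    simp only [Pi.add_apply, ← Finset.sum_add_distrib, ← add_mul, skewCoeff_wordPoly]
    refine Finset.sum_congr rfl fun i _ => ?_
    split_ifs <;> simp
  map_smul' r a := by
    funext j
    simp only [Pi.smul_apply, smul_eq_mul, Finset.mul_sum, skewCoeff_wordPoly, RingHom.id_apply]
    refine Finset.sum_congr rfl fun i _ => ?_
    split_ifs <;> simp [mul_assoc]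

/-- A multiplier of length `n - deg f` keeps the product in degrees below `n`, so truncating to `n`
coefficients loses nothing. -/
theorem wordPoly_mulRightWord {f : SkewPoly θ} {n : ℕ} (hd : skewDegree f ≤ n)
    (m : Fin (n - skewDegree f) → F) :
    wordPoly θ (mulRightWord f (n - skewDegree f) n m) = wordPoly θ m * f := by
  refine skewPoly_ext fun k => ?_
  rw [skewCoeff_wordPoly]
  split_ifs with h
  · exact (skewCoeff_mul _ _ _).symm
  · rw [skewCoeff_mul]
    refine (Finset.sum_eq_zero fun i _ => ?_).symm
    rcases lt_or_ge i (n - skewDegree f) with hi | hi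
    · rw [skewCoeff_eq_zero_of_degree_lt (f := f) (by omega), (iterate_eq_zero_iff i).2 rfl,
        mul_zero]
    · rw [skewCoeff_wordPoly, dif_neg (by omega), zero_mul]

theorem mul_right_cancel_skew {f p : SkewPoly θ} (hf : f ≠ 0) (h : p * f = 0) : p = 0 := by
  by_contra hp
  have := skewCoeff_mul_add (f := p) (g := f) (fun _ => skewCoeff_eq_zero_of_degree_lt)
      (fun _ => skewCoeff_eq_zero_of_degree_lt)
  rw [h, skewCoeff_zero] at this
  exact mul_ne_zero (skewCoeff_degree_ne_zero hp)
    (mt (iterate_eq_zero_iff _).1 (skewCoeff_degree_ne_zero hf)) this.symm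

theorem mulRightWord_injective {f : SkewPoly θ} (hf : f ≠ 0) {n : ℕ} (hd : skewDegree f ≤ n) :
    Function.Injective (mulRightWord f (n - skewDegree f) n) := by
  intro a b hab
  refine wordPoly_injective θ _ (sub_eq_zero.1 (mul_right_cancel_skew hf ?_))
  rw [sub_mul, ← wordPoly_mulRightWord hd, ← wordPoly_mulRightWord hd, hab, sub_self]

theorem finrank_range_mulRightWord {f : SkewPoly θ} (hf : f ≠ 0) {n : ℕ} (hd : skewDegree f ≤ n) :
    Module.finrank F (LinearMap.range (mulRightWord f (n - skewDegree f) n))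
      = n - skewDegree f := by
  rw [LinearMap.finrank_range_of_inj (mulRightWord_injective hf hd), Module.finrank_fin_fun]

theorem skewCoeff_skewDagger (h : SkewPoly θ) (j : ℕ) :
    skewCoeff (skewDagger h) j
      = if j ≤ skewDegree h then (θ : F → F)^[j] (skewCoeff h (skewDegree h - j)) else 0 := by
  rw [skewDagger, skewCoeff_sum]
  simp only [skewCoeff_monomial, Finset.sum_ite_eq', Finset.mem_range, Nat.lt_succ_iff]

theorem skewDegree_skewDagger {h : SkewPoly θ} (h0 : skewCoeff h 0 ≠ 0) :
    skewDegree (skewDagger h) = skewDegree h := by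
  refine le_antisymm (skewDegree_le fun k hk => ?_) (le_skewDegree ?_)
  · rw [skewCoeff_skewDagger, if_neg (by omega)]
  · rw [skewCoeff_skewDagger, if_pos le_rfl, Nat.sub_self]
    exact mt (iterate_eq_zero_iff _).1 h0

theorem skewDagger_ne_zero {h : SkewPoly θ} (hh : h ≠ 0) : skewDagger h ≠ 0 := fun e => by
  have := skewCoeff_skewDagger h 0
  rw [e, skewCoeff_zero, if_pos (Nat.zero_le _)] at this
  exact skewCoeff_degree_ne_zero hh this.symm

/-- The pairing of a word `c` with a shift of `h†` is a coefficient of `c h`. -/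
theorem dotProduct_mulRightWord_skewDagger {h : SkewPoly θ} {n : ℕ} (hd : skewDegree h ≤ n)
    (c : Fin n → F) (m : Fin (n - skewDegree h) → F) :
    c ⬝ᵥ mulRightWord (skewDagger h) (n - skewDegree h) n m
      = ∑ s : Fin (n - skewDegree h), m s * skewCoeff (wordPoly θ c * h) (skewDegree h + s) := by
  -- The twist `θ^s` of the multiplier and the twist `θ^(j-s)` built into `h†` combine to `θ^j`, the
  -- twist that `c_j` produces in `c h`. Both sides become the same sum over the band `s ≤ j ≤ deg h
  -- + s`.
  have h1 : ∀ j : Fin n, mulRightWord (skewDagger h) (n - skewDegree h) n m j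
      = ∑ s : Fin (n - skewDegree h), m s *
        if (s : ℕ) ≤ j ∧ (j : ℕ) ≤ skewDegree h + s then
          (θ : F → F)^[j] (skewCoeff h (skewDegree h + s - j)) else 0 := by
    intro j
    rw [Finset.sum_congr rfl fun s _ => by rw [← skewCoeff_wordPoly_fin (θ := θ) m s],
      Fin.sum_univ_eq_sum_range (fun i => skewCoeff (wordPoly θ m) i *
        if i ≤ (j : ℕ) ∧ (j : ℕ) ≤ skewDegree h + i then
          (θ : F → F)^[j] (skewCoeff h (skewDegree h + i - j)) else 0)]
    change ∑ i ∈ Finset.range ((j : ℕ) + 1), _ = _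
    have hj := j.2
    rw [Finset.sum_congr rfl fun i hi => show _ = skewCoeff (wordPoly θ m) i *
        if i ≤ (j : ℕ) ∧ (j : ℕ) ≤ skewDegree h + i then
          (θ : F → F)^[j] (skewCoeff h (skewDegree h + i - j)) else 0 from ?_]
    · rw [Finset.sum_subset (s₂ := Finset.range n) (by simp),
        ← Finset.sum_subset (s₁ := Finset.range (n - skewDegree h)) (s₂ := Finset.range n)
          (by rw [Finset.range_subset_range]; omega)]
      · intro i _ hi
        rw [skewCoeff_wordPoly, dif_neg (by simpa using hi), zero_mul]
      · intro i _ hi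
        rw [Finset.mem_range] at hi
        rw [if_neg (by omega), mul_zero]
    · rw [Finset.mem_range] at hi
      rw [skewCoeff_skewDagger]
      by_cases hji : (j : ℕ) - i ≤ skewDegree h
      · rw [if_pos hji, if_pos (by omega), ← Function.iterate_add_apply]
        congr 3 <;> omega
      · rw [if_neg hji, if_neg (by omega), (iterate_eq_zero_iff i).2 rfl]
  have h2 : ∀ s : Fin (n - skewDegree h), skewCoeff (wordPoly θ c * h) (skewDegree h + s)
      = ∑ j : Fin n, c j * if (s : ℕ) ≤ j ∧ (j : ℕ) ≤ skewDegree h + s then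
          (θ : F → F)^[j] (skewCoeff h (skewDegree h + s - j)) else 0 := by
    intro s
    have hs := s.2
    rw [skewCoeff_mul]
    rw [Finset.sum_congr (s₁ := (Finset.univ : Finset (Fin n))) rfl fun j _ => by
        rw [← skewCoeff_wordPoly_fin (θ := θ) c j],
      Fin.sum_univ_eq_sum_range (fun j => skewCoeff (wordPoly θ c) j *
        if (s : ℕ) ≤ j ∧ j ≤ skewDegree h + s then
          (θ : F → F)^[j] (skewCoeff h (skewDegree h + s - j)) else 0),
      ← Finset.sum_subset (s₁ := Finset.range (skewDegree h + s + 1)) (s₂ := Finset.range n)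
        (by rw [Finset.range_subset_range]; omega)]
    · refine Finset.sum_congr rfl fun j hj => ?_
      rw [Finset.mem_range] at hj
      by_cases hsj : (s : ℕ) ≤ j
      · rw [if_pos (by omega)]
      · rw [if_neg (by omega), skewCoeff_eq_zero_of_degree_lt (f := h) (by omega),
          (iterate_eq_zero_iff j).2 rfl]
    · intro j _ hj
      rw [Finset.mem_range] at hj
      rw [if_neg (by omega), mul_zero]
  simp only [dotProduct, h1, h2, Finset.mul_sum]
  rw [Finset.sum_comm]
  exact Finset.sum_congr rfl fun s _ => Finset.sum_congr rfl fun j _ => mul_left_comm _ _ _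

/-- The modulus `h g` is itself a left multiple of `g`, so passing to the quotient adds nothing to
the left multiples of `g`. -/
theorem mem_iff_of_isGeneratedBy {n : ℕ} {α : F} {C : Submodule F (Fin n → F)} {g h : SkewPoly θ}
    (hgen : IsGeneratedBy θ α C g) (hhg : xPowSub θ n α = h * g) (c : Fin n → F) :
    c ∈ C ↔ ∃ m, wordPoly θ c = m * g := by
  rw [hgen c, Submodule.mem_span_singleton]
  constructor
  · rintro ⟨p, hp⟩
    rw [← map_smul, Submodule.mkQ_apply, Submodule.mkQ_apply, Submodule.Quotient.eq', modIdeal,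
      Submodule.mem_span_singleton] at hp
    obtain ⟨r, hr⟩ := hp
    refine ⟨r * h + p, ?_⟩
    rw [add_mul, mul_assoc, ← hhg]
    rw [smul_eq_mul, smul_eq_mul] at hr
    rw [hr]
    abel
  · rintro ⟨m, hm⟩
    exact ⟨m, by rw [hm, ← smul_eq_mul, map_smul]⟩

/-- A code with `g ∣ h†` contains its dual and has dimension `n - deg g`. -/
theorem dual_le_and_finrank_of_isGeneratedBy {n : ℕ} (hn : 0 < n) {α : F} (hα : α ≠ 0)
    {C : Submodule F (Fin n → F)} {g h : SkewPoly θ} (hgen : IsGeneratedBy θ α C g)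
    (hhg : xPowSub θ n α = h * g) (hgh : xPowSub θ n α = g * h)
    (hdvd : RightDivides g (skewDagger h)) :
    (∀ v, (∀ c ∈ C, c ⬝ᵥ v = 0) → v ∈ C) ∧ Module.finrank F C + skewDegree g = n := by
  have hg0 : g ≠ 0 := by
    rintro rfl
    exact xPowSub_ne_zero hn α (hgh.trans (zero_mul h))
  have hh0 : h ≠ 0 := by
    rintro rfl
    exact xPowSub_ne_zero hn α (hgh.trans (mul_zero g))
  have hdeg : skewDegree g + skewDegree h = n := by
    rw [← skewDegree_mul hg0 hh0, ← hgh, skewDegree_xPowSub hn]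
  -- The constant terms multiply to `-α`. This makes the leading coefficient of `h†` nonzero, so
  -- `h†` keeps the degree of `h`.
  have hconst : skewCoeff h 0 ≠ 0 := by
    intro e
    have h1 := skewCoeff_xPowSub (θ := θ) n α 0
    rw [hhg, skewCoeff_mul, if_neg hn.ne', if_pos rfl, zero_sub, zero_add, Finset.sum_range_one, e,
      zero_mul] at h1
    exact hα (neg_eq_zero.1 h1.symm)
  have hmem := mem_iff_of_isGeneratedBy hgen hhg
  have hdag := skewDegree_skewDagger hconst
  have hle : LinearMap.range (mulRightWord g (n - skewDegree g) n) ≤ C := by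
    rintro _ ⟨m, rfl⟩
    exact (hmem _).2 ⟨_, wordPoly_mulRightWord (by omega) m⟩
  have hDC : LinearMap.range (mulRightWord (skewDagger h) (n - skewDegree (skewDagger h)) n) ≤ C := by
    rintro _ ⟨m, rfl⟩
    obtain ⟨p, hp⟩ := hdvd
    exact (hmem _).2 ⟨wordPoly θ m * p, by
      rw [wordPoly_mulRightWord (by omega) m, mul_assoc, ← hp]⟩
  have horth : LinearMap.range (mulRightWord (skewDagger h) (n - skewDegree (skewDagger h)) n)
      ≤ dualCode C := by
    rw [hdag]
    rintro _ ⟨m, rfl⟩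
    refine mem_dualCode.2 fun c hc => ?_
    obtain ⟨p, hp⟩ := (hmem c).1 hc
    have hpk : ∀ k, skewDegree h ≤ k → skewCoeff p k = 0 := by
      intro k hk
      by_contra hne
      have hp0 : p ≠ 0 := by
        rintro rfl
        exact hne (skewCoeff_zero k)
      have h1 := skewDegree_wordPoly_lt (θ := θ) hn c
      rw [hp, skewDegree_mul hp0 hg0] at h1
      have h2 := le_skewDegree hne
      omega
    rw [dotProduct_mulRightWord_skewDagger (by omega)]
    refine Finset.sum_eq_zero fun s _ => ?_
    have hs := s.2
    rw [hp, mul_assoc, ← hgh]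
    rw [skewCoeff_mul]
    -- For `i < deg h` the index `deg h + s - i` lies strictly between `0` and `n`, where `x^n - α`
    -- has no term; for larger `i`, `p` has none.
    suffices hz : ∀ i ∈ Finset.range (skewDegree h + s + 1), skewCoeff p i *
        (θ : F → F)^[i] (skewCoeff (xPowSub θ n α) (skewDegree h + s - i)) = 0 by
      rw [Finset.sum_eq_zero hz, mul_zero]
    intro i hi
    rw [Finset.mem_range] at hi
    rcases Nat.lt_or_ge i (skewDegree h) with hlt | hge
    · rw [skewCoeff_xPowSub, if_neg (by omega), if_neg (by omega), sub_zero,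
        (iterate_eq_zero_iff i).2 rfl, mul_zero]
    · rw [hpk i hge, zero_mul]
  -- The code has dimension at least `n - deg g` and its dual at least `n - deg h = deg g`. The two
  -- dimensions add up to `n`, so both bounds are equalities.
  have f1 := Submodule.finrank_mono hle
  rw [finrank_range_mulRightWord hg0 (by omega)] at f1
  have f2 := Submodule.finrank_mono horth
  rw [finrank_range_mulRightWord (skewDagger_ne_zero hh0) (by omega), hdag] at f2
  have f3 := finrank_add_finrank_dualCode C
  rw [Fintype.card_fin] at f3
  have heq := Submodule.eq_of_le_of_finrank_eq horth (by
    rw [finrank_range_mulRightWord (skewDagger_ne_zero hh0) (by omega), hdag]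
    omega)
  exact ⟨fun v hv => hDC (heq ▸ mem_dualCode.2 hv), by omega⟩

end SkewPolynomials

/-! ### The CSS construction and its minimum distance. -/

section QuantumCodes

/-- For `δ > N` every matrix unit is a detectable error, which is too much for a nonzero `Q`. This
bound is what makes a largest `δ` exist. -/
theorem DetectsBelow.le_length {A : Type*} [Fintype A] [DecidableEq A] [Nontrivial A] {N : ℕ}
    (hN : 0 < N) {Q : Submodule ℂ (QuditSpace A N)} (hQ : Q ≠ ⊥) {δ : ℕ} (h : DetectsBelow Q δ) :
    δ ≤ N := by
  by_contra! hlt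
  have hE : ∀ x y : Fin N → A, ∃ c : ℂ,
      (∀ u ∈ Q, ∀ v ∈ Q, star (u x) * v y = c * inner ℂ u v) ∧
      (Module.finrank ℂ Q = 1 → c = (if x = y then 1 else 0) / (Fintype.card A : ℂ) ^ N) := by
    intro x y
    have hxy : errorOperator (fun t => Matrix.single (x t) (y t) (1 : ℂ)) = Matrix.single x y 1 := by
      ext a b
      simp only [errorOperator, Matrix.of_apply, Matrix.single_apply, Finset.prod_ite_zero,
        Finset.prod_const_one, Finset.mem_univ, true_imp_iff, forall_and, funext_iff]
    obtain ⟨c, hc, htr⟩ := h (fun t => Matrix.single (x t) (y t) 1)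
      (lt_of_le_of_lt ((Finset.card_le_univ _).trans (by simp)) hlt)
    rw [hxy] at hc htr
    refine ⟨c, fun u hu v hv => ?_, fun h1 => ?_⟩
    · rw [← hc u hu v hv]
      simp [PiLp.inner_apply, Matrix.toLpLin_apply, Matrix.single_mulVec, Function.update_apply, mul_comm]
    · rw [htr h1]
      split_ifs with e
      · rw [e, Matrix.trace_single_eq_same]
      · rw [Matrix.trace_single_eq_of_ne _ _ _ e]
  have hnz : ∀ u : QuditSpace A N, u ≠ 0 → ∃ x, u x ≠ 0 := by
    intro u hu0
    by_contra! hz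
    exact hu0 (by ext x; exact hz x)
  -- On a line, purity kills `u y` through an off-diagonal unit, while the diagonal unit at `y` has
  -- nonzero trace. Otherwise, a matrix unit links the supports of two orthogonal vectors.
  by_cases h1 : Module.finrank ℂ Q = 1
  · obtain ⟨u, hu, hu0⟩ := Submodule.exists_mem_ne_zero_of_ne_bot hQ
    obtain ⟨x, hx⟩ := hnz u hu0
    have : Nonempty (Fin N) := ⟨⟨0, hN⟩⟩
    obtain ⟨y, hy⟩ := exists_ne x
    have hq : ((Fintype.card A : ℂ) ^ N) ≠ 0 := pow_ne_zero _ (by simp)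
    obtain ⟨c, hc, htr⟩ := hE x y
    have e1 := hc u hu u hu
    rw [htr h1, if_neg hy.symm, zero_div, zero_mul] at e1
    have huy : u y = 0 := (mul_eq_zero.1 e1).resolve_left (star_ne_zero.2 hx)
    obtain ⟨c, hc, htr⟩ := hE y y
    have e2 := hc u hu u hu
    rw [htr h1, if_pos rfl, huy, mul_zero] at e2
    exact (mul_ne_zero (div_ne_zero one_ne_zero hq) (inner_self_ne_zero.2 hu0)) e2.symm
  · have hpos : Module.finrank ℂ Q ≠ 0 := fun e => hQ (Submodule.finrank_eq_zero.1 e)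
    let b := stdOrthonormalBasis ℂ Q
    have hb : inner ℂ (b ⟨0, by omega⟩ : QuditSpace A N) (b ⟨1, by omega⟩) = 0 :=
      b.orthonormal.2 (by simp)
    have hb0 : ∀ i, (b i : QuditSpace A N) ≠ 0 := fun i e =>
      b.orthonormal.ne_zero i (Subtype.ext e)
    obtain ⟨x, hx⟩ := hnz _ (hb0 ⟨0, by omega⟩)
    obtain ⟨y, hy⟩ := hnz _ (hb0 ⟨1, by omega⟩)
    obtain ⟨c, hc, -⟩ := hE x y
    have e1 := hc _ (b ⟨0, by omega⟩).2 _ (b ⟨1, by omega⟩).2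
    rw [hb, mul_zero] at e1
    exact mul_ne_zero (star_ne_zero.2 hx) hy e1

variable {F : Type*} [Field F] {N : ℕ}

/-- The wave functions supported on `D` and invariant under translations by the dual code. -/
noncomputable def cssEmbedding (D : Submodule F (Fin N → F)) :
    ((D ⧸ (dualCode D).comap D.subtype) → ℂ) →ₗ[ℂ] QuditSpace F N := by
  classical exact
  { toFun := fun φ => WithLp.toLp 2 fun x =>
      if h : x ∈ D then φ (Submodule.Quotient.mk ⟨x, h⟩) else 0
    map_add' := fun φ ψ => by
      ext x
      by_cases h : x ∈ D <;> simp [h]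
    map_smul' := fun r φ => by
      ext x
      by_cases h : x ∈ D <;> simp [h] }

/-- The quantum code of a classical code `D` (the CSS construction). -/
noncomputable def cssCode (D : Submodule F (Fin N → F)) : Submodule ℂ (QuditSpace F N) :=
  LinearMap.range (cssEmbedding D)

theorem cssEmbedding_injective (D : Submodule F (Fin N → F)) :
    Function.Injective (cssEmbedding D) := by
  intro φ ψ h
  funext p
  obtain ⟨x, rfl⟩ := Submodule.Quotient.mk_surjective _ p
  have := congrArg (fun u : QuditSpace F N => u x) h
  simpa [cssEmbedding] using this

theorem apply_eq_zero_of_mem_cssCode {D : Submodule F (Fin N → F)} {u : QuditSpace F N}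
    (hu : u ∈ cssCode D) {x : Fin N → F} (hx : x ∉ D) : u x = 0 := by
  obtain ⟨φ, rfl⟩ := hu
  simp [cssEmbedding, hx]

theorem apply_add_of_mem_cssCode {D : Submodule F (Fin N → F)} (hD : dualCode D ≤ D)
    {u : QuditSpace F N} (hu : u ∈ cssCode D) (x : Fin N → F) {z : Fin N → F}
    (hz : z ∈ dualCode D) : u (x + z) = u x := by
  obtain ⟨φ, rfl⟩ := hu
  by_cases hx : x ∈ D
  · have hxz : x + z ∈ D := D.add_mem hx (hD hz)
    simp only [cssEmbedding, LinearMap.coe_mk, AddHom.coe_mk, hx, hxz, dif_pos]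
    refine congrArg φ ((Submodule.Quotient.eq _).2 ?_)
    simpa using hz
  · have hxz : x + z ∉ D := fun h => hx (by simpa using D.sub_mem h (hD hz))
    simp [cssEmbedding, hx, hxz]

/-- The dimension is the number of cosets of the dual in `D`. -/
theorem finrank_cssCode [Fintype F] {D : Submodule F (Fin N → F)} (hD : dualCode D ≤ D) :
    Module.finrank ℂ (cssCode D) = Fintype.card F ^ (2 * Module.finrank F D - N) := by
  classical
  have := Fintype.ofFinite (D ⧸ (dualCode D).comap D.subtype)
  rw [cssCode, LinearMap.finrank_range_of_inj (cssEmbedding_injective D),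
    Module.finrank_fintype_fun_eq_card, Module.card_eq_pow_finrank (K := F)]
  congr 1
  have h1 := Submodule.finrank_quotient_add_finrank ((dualCode D).comap D.subtype)
  have h2 := (Submodule.comapSubtypeEquivOfLe hD).finrank_eq
  have h3 := finrank_add_finrank_dualCode D
  rw [Fintype.card_fin] at h3
  omega

/-- A code without nonzero words supported on `S` has a dual code that is everything on `S`. -/
theorem exists_mem_dualCode_eqOn (D : Submodule F (Fin N → F)) (S : Finset (Fin N))
    (hS : ∀ x ∈ D, (∀ t ∉ S, x t = 0) → x = 0) (y : Fin N → F) :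
    ∃ z ∈ dualCode D, ∀ t ∈ S, z t = y t := by
  let Z : Submodule F (Fin N → F) :=
    { carrier := {v | ∀ t ∈ S, v t = 0}
      add_mem' := fun ha hb t ht => by simp [ha t ht, hb t ht]
      zero_mem' := fun t _ => rfl
      smul_mem' := fun r a ha t ht => by simp [ha t ht] }
  -- A vector orthogonal to both summands is a word of `D` supported on `S`.
  have hbot : dualCode (dualCode D ⊔ Z) = ⊥ := by
    rw [eq_bot_iff]
    intro x hx
    have h1 : x ∈ D := by
      rw [← dualCode_dualCode D]
      exact mem_dualCode.2 fun c hc => mem_dualCode.1 hx c (Submodule.mem_sup_left hc)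
    refine hS x h1 fun t ht => ?_
    have := mem_dualCode.1 hx (Pi.single t 1) (Submodule.mem_sup_right fun s hs =>
      Pi.single_eq_of_ne (fun e => ht (by rwa [← e])) 1)
    simpa using this
  have htop : dualCode D ⊔ Z = ⊤ := by
    rw [← dualCode_dualCode (dualCode D ⊔ Z), hbot]
    exact LinearMap.BilinForm.orthogonal_bot
  obtain ⟨z, hz, w, hw, hzw⟩ := Submodule.mem_sup.1 (htop ▸ Submodule.mem_top : y ∈ dualCode D ⊔ Z)
  exact ⟨z, hz, fun t ht => by rw [← hzw, Pi.add_apply, hw t ht, add_zero]⟩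

theorem codeDist_le_of_mem [DecidableEq F] {D : Submodule F (Fin N → F)} {x y : Fin N → F} (hx : x ∈ D)
    (hy : y ∈ D) (h : x ≠ y) : codeDist (D : Set (Fin N → F)) ≤ hammingDist x y :=
  Nat.sInf_le ⟨x, hx, y, hy, h, rfl⟩

theorem eq_of_eqOn_compl [DecidableEq F] {D : Submodule F (Fin N → F)} {S : Finset (Fin N)}
    (hS : S.card < codeDist (D : Set (Fin N → F))) {x y : Fin N → F} (hx : x ∈ D) (hy : y ∈ D)
    (h : ∀ t ∉ S, x t = y t) : x = y := by
  by_contra hne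
  refine absurd (codeDist_le_of_mem hx hy hne) (not_le.2 (lt_of_le_of_lt ?_ hS))
  refine Finset.card_le_card fun t ht => ?_
  by_contra hts
  exact (Finset.mem_filter.1 ht).2 (h t hts)

theorem detectsBelow_cssCode [Fintype F] [DecidableEq F] {D : Submodule F (Fin N → F)}
    (hD : dualCode D ≤ D) : DetectsBelow (cssCode D) (codeDist (D : Set (Fin N → F))) := by
  classical
  intro E hE
  obtain ⟨S, hSdef⟩ : ∃ S : Finset (Fin N), ∀ t, t ∈ S ↔ E t ≠ 1 :=
    ⟨Finset.univ.filter fun t => E t ≠ 1, fun t => by simp⟩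
  have hScard : S.card < codeDist (D : Set (Fin N → F)) := by
    convert hE using 1
    exact congrArg Finset.card (by ext t; simp [hSdef])
  have hE1 : ∀ t ∉ S, E t = 1 := fun t ht => not_not.1 (mt (hSdef t).2 ht)
  refine ⟨(errorOperator E).trace / (Fintype.card F : ℂ) ^ N, fun u hu v hv => ?_, fun _ => rfl⟩
  have hdiag : inner ℂ u (Matrix.toEuclideanLin (errorOperator E) v)
      = ∑ x, star (u x) * v x * errorOperator E x x := by
    rw [PiLp.inner_apply]
    refine Finset.sum_congr rfl fun x _ => ?_
    rw [Matrix.toLpLin_apply]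
    by_cases hx : x ∈ D
    · have : (errorOperator E *ᵥ v.ofLp) x = errorOperator E x x * v x := by
        rw [Matrix.mulVec, dotProduct, Finset.sum_eq_single x]
        · intro y _ hyx
          by_cases hy : y ∈ D
          · obtain ⟨t, ht, hne⟩ : ∃ t ∉ S, x t ≠ y t := by
              by_contra! hcon
              exact hyx (eq_of_eqOn_compl hScard hx hy hcon).symm
            have : errorOperator E x y = 0 := Finset.prod_eq_zero (Finset.mem_univ t) (by
              rw [hE1 t ht, Matrix.one_apply_ne hne])
            rw [this, zero_mul]
          · rw [apply_eq_zero_of_mem_cssCode hv hy, mul_zero]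
        · exact fun h => absurd (Finset.mem_univ x) h
      simp only [this, RCLike.inner_apply, starRingEnd_apply]
      ring
    · simp [apply_eq_zero_of_mem_cssCode hu hx]
  have hinner : inner ℂ u v = ∑ x, star (u x) * v x := by
    rw [PiLp.inner_apply]
    exact Finset.sum_congr rfl fun x _ => by
      rw [RCLike.inner_apply, starRingEnd_apply, mul_comm]
  have hdep : ∀ x y : Fin N → F, (∀ t ∈ S, x t = y t) → errorOperator E x x = errorOperator E y y := by
    intro x y hxy
    change ∏ t, E t (x t) (x t) = ∏ t, E t (y t) (y t)
    refine Finset.prod_congr rfl fun t _ => ?_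
    by_cases ht : t ∈ S
    · rw [hxy t ht]
    · rw [hE1 t ht, Matrix.one_apply_eq, Matrix.one_apply_eq]
  have havg : ∀ x : Fin N → F, (Fintype.card F : ℂ) ^ N *
      ∑ z : dualCode D, errorOperator E (x + z) (x + z)
      = Fintype.card (dualCode D) * (errorOperator E).trace := by
    intro x
    -- Some dual word agrees with `y` on `S`, so shifting by `y` only reindexes the sum. Summing
    -- over all `y` then produces the trace.
    have h1 : ∀ y : Fin N → F, ∑ z : dualCode D, errorOperator E (x + z) (x + z)
        = ∑ z : dualCode D, errorOperator E (y + (x + z)) (y + (x + z)) := by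
      intro y
      obtain ⟨w, hw, hwy⟩ := exists_mem_dualCode_eqOn D S
        (fun x hx h => eq_of_eqOn_compl hScard hx D.zero_mem h) y
      rw [← Equiv.sum_comp (Equiv.addLeft (⟨w, hw⟩ : dualCode D))]
      refine Finset.sum_congr rfl fun z _ => hdep _ _ fun t ht => ?_
      simp only [Equiv.coe_addLeft, Submodule.coe_add, Pi.add_apply, hwy t ht]
      ring
    have h2 : ∑ y : Fin N → F, ∑ z : dualCode D, errorOperator E (x + z) (x + z)
        = Fintype.card (dualCode D) * (errorOperator E).trace := by
      rw [Finset.sum_congr rfl fun y _ => h1 y, Finset.sum_comm]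
      have h3 : ∀ z : dualCode D, ∑ y : Fin N → F,
          errorOperator E (y + (x + (z : Fin N → F))) (y + (x + (z : Fin N → F)))
            = (errorOperator E).trace := fun z =>
        Equiv.sum_comp (Equiv.addRight (x + (z : Fin N → F))) fun y => errorOperator E y y
      rw [Finset.sum_congr rfl fun z _ => h3 z, Finset.sum_const, Finset.card_univ, nsmul_eq_mul]
    rw [← h2, Finset.sum_const, Finset.card_univ, nsmul_eq_mul]
    simp
  have hq : ((Fintype.card F : ℂ) ^ N) ≠ 0 := pow_ne_zero _ (by simp)
  have hd : (Fintype.card (dualCode D) : ℂ) ≠ 0 := by simp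
  have hinv : ∀ z : dualCode D, ∑ x, star (u x) * v x * errorOperator E x x
      = ∑ x, star (u x) * v x * errorOperator E (x + z) (x + z) := by
    intro z
    rw [← Equiv.sum_comp (Equiv.addRight (z : Fin N → F))]
    refine Finset.sum_congr rfl fun x _ => ?_
    rw [Equiv.coe_addRight, apply_add_of_mem_cssCode hD hu x z.2,
      apply_add_of_mem_cssCode hD hv x z.2]
  have hsum : Fintype.card (dualCode D) * ∑ x, star (u x) * v x * errorOperator E x x
      = ∑ x, star (u x) * v x * ∑ z : dualCode D, errorOperator E (x + z) (x + z) := by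
    rw [← nsmul_eq_mul, ← Finset.card_univ, ← Finset.sum_const,
      Finset.sum_congr rfl fun z _ => hinv z, Finset.sum_comm]
    simp only [Finset.mul_sum]
  rw [hdiag, hinner, div_mul_eq_mul_div, eq_div_iff hq]
  refine mul_left_cancel₀ hd ?_
  rw [← mul_assoc, hsum, Finset.sum_mul, ← mul_assoc, Finset.mul_sum]
  refine Finset.sum_congr rfl fun x _ => ?_
  rw [← havg x]
  ring

theorem exists_isQuantumCode_of_dualCode_le [Fintype F] [DecidableEq F] (hN : 0 < N)
    {D : Submodule F (Fin N → F)} (hD : dualCode D ≤ D) :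
    ∃ (Q : Submodule ℂ (QuditSpace F N)) (d : ℕ),
      IsQuantumCode Q (2 * Module.finrank F D - N) d ∧ codeDist (D : Set (Fin N → F)) ≤ d := by
  have hfin := finrank_cssCode hD
  have hne : cssCode D ≠ ⊥ := fun h => by
    rw [h, finrank_bot] at hfin
    exact (pow_pos Fintype.card_pos _).ne hfin
  have hbdd : BddAbove {δ | DetectsBelow (cssCode D) δ} :=
    ⟨N, fun δ hδ => DetectsBelow.le_length hN hne hδ⟩
  have hdet := detectsBelow_cssCode hD
  exact ⟨cssCode D, sSup {δ | DetectsBelow (cssCode D) δ},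
    ⟨hfin, Nat.sSup_mem ⟨_, hdet⟩ hbdd, fun δ hδ => le_csSup hbdd hδ⟩, le_csSup hbdd hdet⟩

end QuantumCodes

/-! ### The Gray map and assembly of the components. -/

section GrayMap

variable {F : Type*} [Field F] {l n : ℕ}

/-- The Gray map as a linear map. -/
def grayLinearMap (M : Fin n → GL (Fin l) F) :
    (Fin n → (Fin l → F)) →ₗ[F] (Fin (n * l) → F) where
  toFun := grayMap M
  map_add' c d := by
    funext t
    simp only [grayMap, Pi.add_apply, Matrix.add_vecMul]
  map_smul' r c := by
    funext t
    simp only [grayMap, Pi.smul_apply, Matrix.smul_vecMul, RingHom.id_apply]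

theorem grayMap_finProdFinEquiv (M : Fin n → GL (Fin l) F) (c : Fin n → (Fin l → F)) (j : Fin n)
    (k : Fin l) : grayMap M c (finProdFinEquiv (j, k)) = (c j ᵥ* (M j : Matrix (Fin l) (Fin l) F)) k := by
  rw [grayMap, Equiv.symm_apply_apply]

theorem grayMap_dotProduct {M : Fin n → GL (Fin l) F} {lam : F}
    (hM : ∀ j, (M j : Matrix (Fin l) (Fin l) F) * (M j : Matrix (Fin l) (Fin l) F)ᵀ
      = lam • (1 : Matrix (Fin l) (Fin l) F)) (c d : Fin n → (Fin l → F)) :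
    grayMap M c ⬝ᵥ grayMap M d = lam * ∑ j, c j ⬝ᵥ d j := by
  have hj : ∀ j, (c j ᵥ* (M j : Matrix (Fin l) (Fin l) F)) ⬝ᵥ (d j ᵥ* (M j : Matrix _ _ F))
      = lam * (c j ⬝ᵥ d j) := by
    intro j
    rw [← Matrix.mulVec_transpose _ (d j), Matrix.dotProduct_mulVec, Matrix.vecMul_vecMul, hM,
      Matrix.vecMul_smul, Matrix.vecMul_one, smul_dotProduct, smul_eq_mul]
  rw [dotProduct, ← Equiv.sum_comp finProdFinEquiv, Fintype.sum_prod_type, Finset.mul_sum]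
  simp only [grayMap_finProdFinEquiv]
  exact Finset.sum_congr rfl fun j _ => hj j

theorem grayMap_bijective (M : Fin n → GL (Fin l) F) : Function.Bijective (grayLinearMap M) := by
  have hinj : Function.Injective (grayLinearMap M) := by
    intro c d h
    funext j
    refine Matrix.vecMul_injective_of_isUnit (M j).isUnit ?_
    funext k
    have := congrFun h (finProdFinEquiv (j, k))
    rwa [show grayLinearMap M c = grayMap M c from rfl, show grayLinearMap M d = grayMap M d from rfl,
      grayMap_finProdFinEquiv, grayMap_finProdFinEquiv] at this
  refine ⟨hinj, (LinearMap.injective_iff_surjective_of_finrank_eq_finrank ?_).1 hinj⟩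
  simp [Module.finrank_pi_fintype]

/-- The decomposition of a code over `F ^ l` into its components. -/
def componentEquiv (C : Submodule (Fin l → F) (Fin n → (Fin l → F))) :
    C.restrictScalars F ≃ₗ[F] ((i : Fin l) → component C i) where
  toFun c i := ⟨fun j => c.1 j i, (mem_iff_component C c.1).1 c.2 i⟩
  invFun d := ⟨fun j i => (d i).1 j, (mem_iff_component C _).2 fun i => (d i).2⟩
  map_add' _ _ := rfl
  map_smul' _ _ := rfl
  left_inv _ := rfl
  right_inv _ := rfl

theorem finrank_restrictScalars_eq_sum (C : Submodule (Fin l → F) (Fin n → (Fin l → F))) :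
    Module.finrank F (C.restrictScalars F) = ∑ i, Module.finrank F (component C i) := by
  rw [(componentEquiv C).finrank_eq, Module.finrank_pi_fintype]

theorem dualCode_map_grayMap_le {M : Fin n → GL (Fin l) F} {lam : F} (hlam : lam ≠ 0)
    (hM : ∀ j, (M j : Matrix (Fin l) (Fin l) F) * (M j : Matrix (Fin l) (Fin l) F)ᵀ
      = lam • (1 : Matrix (Fin l) (Fin l) F))
    {C : Submodule (Fin l → F) (Fin n → (Fin l → F))}
    (hC : ∀ i v, (∀ c ∈ component C i, c ⬝ᵥ v = 0) → v ∈ component C i) :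
    dualCode ((C.restrictScalars F).map (grayLinearMap M))
      ≤ (C.restrictScalars F).map (grayLinearMap M) := by
  intro v hv
  obtain ⟨w, rfl⟩ := (grayMap_bijective M).2 v
  refine ⟨w, (mem_iff_component C w).2 fun i => hC i _ ?_, rfl⟩
  rintro _ ⟨c, hc, rfl⟩
  -- The idempotent `e_i` isolates the `i`-th component in the scalar product.
  have hmem : (Pi.single i (1 : F) : Fin l → F) • c ∈ C := C.smul_mem _ hc
  have h0 : grayMap M ((Pi.single i (1 : F) : Fin l → F) • c) ⬝ᵥ grayMap M w = 0 :=
    mem_dualCode.1 hv _ ⟨_, hmem, rfl⟩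
  rw [grayMap_dotProduct hM] at h0
  refine Eq.trans (Finset.sum_congr rfl fun j _ => ?_) ((mul_eq_zero.1 h0).resolve_left hlam)
  rw [dotProduct, Finset.sum_eq_single i]
  · simp
  · intro k _ hk
    simp [hk]
  · simp

end GrayMap

theorem mainTheorem6 {F : Type*} [Field F] [Fintype F] [DecidableEq F]
    (l n : ℕ) (hl : 0 < l) (hn : 0 < n)
    -- the automorphism `Θ = θ_1 × ⋯ × θ_l` and the unit `a = (a_1, …, a_l)`
    (θ : Fin l → (F ≃+* F)) (a : (Fin l → F)ˣ)
    -- the matrices of the Gray map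
    (M : Fin n → GL (Fin l) F) (lam : Fˣ)
    (hM : ∀ j, (M j : Matrix (Fin l) (Fin l) F) * (M j : Matrix (Fin l) (Fin l) F)ᵀ
      = (lam : F) • (1 : Matrix (Fin l) (Fin l) F))
    -- the `(Θ, 0, a)`-cyclic code and its components
    (C : Submodule (Fin l → F) (Fin n → (Fin l → F)))
    (hC : IsCyclicCode (RingEquiv.piCongrRight θ) 0 (a : Fin l → F) C)
    (g h : (i : Fin l) → SkewPoly (θ i))
    (hgen : ∀ i, IsGeneratedBy (θ i) ((a : Fin l → F) i) (component C i) (g i))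
    (hhg : ∀ i, xPowSub (θ i) n ((a : Fin l → F) i) = h i * g i)
    (hgh : ∀ i, xPowSub (θ i) n ((a : Fin l → F) i) = g i * h i)
    (hdvd : ∀ i, RightDivides (g i) (skewDagger (h i))) :
    ∃ (Q : Submodule ℂ (QuditSpace F (n * l))) (k d : ℕ),
      IsQuantumCode Q k d ∧
      (k : ℤ) = 2 * ∑ i, ((n : ℤ) - (skewDegree (g i) : ℤ)) - (n : ℤ) * (l : ℤ) ∧
      codeDist (grayMap M '' (C : Set (Fin n → (Fin l → F)))) ≤ d := by
  have hcomp := fun i => dual_le_and_finrank_of_isGeneratedBy hn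
    (fun h0 => not_isUnit_zero (M₀ := F) (h0 ▸ (Pi.isUnit_iff.1 a.isUnit i))) (hgen i) (hhg i) (hgh i) (hdvd i)
  have hD := dualCode_map_grayMap_le lam.ne_zero hM fun i => (hcomp i).1
  obtain ⟨Q, d, hQ, hd⟩ := exists_isQuantumCode_of_dualCode_le (Nat.mul_pos hn hl) hD
  refine ⟨Q, _, d, hQ, ?_, hd⟩
  have hfin : Module.finrank F ((C.restrictScalars F).map (grayLinearMap M))
      = ∑ i, Module.finrank F (component C i) := by
    rw [← finrank_restrictScalars_eq_sum]
    exact (Submodule.equivMapOfInjective _ (grayMap_bijective M).1 _).finrank_eq.symm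
  have hdual := finrank_add_finrank_dualCode ((C.restrictScalars F).map (grayLinearMap M))
  -- This gives `nl ≤ 2 dim D`, so the truncated subtraction in the exponent is exact.
  have hle := Submodule.finrank_mono hD
  rw [Fintype.card_fin] at hdual
  have hsum : ∑ i, ((n : ℤ) - (skewDegree (g i) : ℤ))
      = (∑ i, Module.finrank F (component C i) : ℕ) := by
    rw [Nat.cast_sum]
    exact Finset.sum_congr rfl fun i _ => by have := (hcomp i).2; omega
  rw [hsum, ← hfin, ← Nat.cast_mul]
  omega
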